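/- Let $\mathcal M=(\mathcal S,\{0,1\},(P^a)_a,(r^a)_a)$ be a Markov decision process with a finite non-empty state space $\mathcal S$ and two actions. For $\lambda\in\mathbb R$ let $\mathcal M(\lambda)$ be the penalized MDP in which the reward $r^1_s$ is replaced by $r^1_s-\lambda$ for every $s$. A policy is a map $\pi:\mathcal S\to\{0,1\}$; $P^\pi$ and $r^\pi$ are its transition matrix and reward vector. Assume that $\mathcal M$ is unichain: for every policy $\pi$ the chain $P^\pi$ has a single recurrent class. A gain $g^\pi\in\mathbb R$ and a bias $b^\pi\in\mathbb R^{\mathcal S}$ of $\pi$ are a solution of $g^\pi+b^\pi=r^\pi+P^\pi b^\pi$ ($b^\pi$ is unique up to an additive constant). The policy $\pi$ is Bellman optimal (BO) if $g^\pi+b^\pi_s=\max_{a}\big(r^a_s+\sum_t P^a_{s,t}b^\pi_t\big)$ for every $s$. The activation advantage of $s$ under $\pi$ is $\alpha^\pi_s=r^1_s-r^0_s+\sum_t(P^1_{s,t}-P^0_{s,t})b^\pi_t$, and the optimal activation advantage is $\alpha^*_s=\alpha^\pi_s$ for any BO policy $\pi$; write $\alpha^*_s(\lambda)$ for its value in $\mathcal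 M(\lambda)$. $\mathcal M$ is indexable if for all $\lambda<\lambda'$, every BO policy of $\mathcal M(\lambda)$ activates every state that is activated by some BO policy of $\mathcal M(\lambda')$. The Whittle index of $s$ is the number $\lambda_s$ such that all BO policies of $\mathcal M(\lambda)$ activate $s$ if $\lambda<\lambda_s$, and none does if $\lambda>\lambda_s$. For a unichain matrix $P$ let $\operatorname{diam}(P)$ be the maximum of the expected time $\mathbb E_s[\tau_{s'}]$ to reach $s'$ from $s$ (with $\tau_{s'}=\min\{k\ge0: X_k=s'\}$) over all states $s$ and recurrent states $s'$. For an MDP $\widehat{\mathcal M}$ with transition matrices $\widehat P^a$ and the same rewards as $\mathcal M$ let $\|\mathcal M-\widehat{\mathcal M}\|_\infty=\max_{a}\max_s\sum_t|P^a_{s,t}-\widehat P^a_{s,t}|$. **Statement.** Let $\mathcal M$ be unichain and indexable. Then every state $s$ has a (finite) Whittle index $\lambda_s$, and there are constants $\delta_{\mathcal M},c_{\mathcal M}>0$ that depend only on $\mathcal M$ such that the following holds for every MDP $\widehat{\mathcal M}$ on $\mathcal S$ with the same rewards and the same support as $\mathcal M$ ($\widehat P^a_{s,t}>0\iff P^a_{s,t}>0$)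 that is close to $\mathcal M$ in the sense that $\|\mathcal M-\widehat{\mathcal M}\|_\infty\cdot\max_\pi\operatorname{diam}(P^\pi)\le1$ and $\|\mathcal M-\widehat{\mathcal M}\|_\infty\le\frac12|\lambda_s-\lambda_{s'}|$ whenever $\lambda_s\ne\lambda_{s'}$. Denote by $\hat\alpha^*_s(\lambda)$ the optimal activation advantage of $s$ in $\widehat{\mathcal M}(\lambda)$. (i) If $\|\mathcal M-\widehat{\mathcal M}\|_\infty\le\delta_{\mathcal M}$, then for every $\lambda$ in one of the intervals $[\lambda_s+\delta_{\mathcal M},\lambda_{s'}-\delta_{\mathcal M}]$ between consecutive Whittle indices (including the two unbounded intervals, to the left of the smallest and to the right of the largest Whittle index), the BO policy of $\widehat{\mathcal M}(\lambda)$ is unique, and it is the unique BO policy of $\mathcal M(\lambda)$. Quantitatively, whatever the size of $\delta_{\mathcal M}$, the same conclusion holds for every $\lambda$ with $|\lambda-\lambda_s|>c_{\mathcal M}\|\mathcal M-\widehat{\mathcal M}\|_\infty$ for all $s\in\mathcal S$. (ii) For every state $s$ there is a $\hat\lambda\in\mathbb R$ with $\hat\alpha^*_s(\hat\lambda)=0$,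 and every such $\hat\lambda$ satisfies $|\lambda_s-\hat\lambda|\le c_{\mathcal M}\|\mathcal M-\widehat{\mathcal M}\|_\infty$. -/

import Mathlib

open scoped ENNReal

/-- A finite Markov decision process with state space `S` and the two actions `0` (rest) and
`1` (activate): `P a s t` is the probability of moving from `s` to `t` under action `a`, and
`r a s` is the reward earned in state `s` under action `a`. -/
structure TwoActionMDP (S : Type*) [Fintype S] where
  P : Fin 2 → S → S → ℝ
  r : Fin 2 → S → ℝ
  P_nonneg : ∀ a s t, 0 ≤ P a s t
  P_sum : ∀ a s, ∑ t, P a s t = 1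

/-- `t` is accessible from `s` in the chain with transition kernel `P`. -/
def Reaches {S : Type*} (P : S → S → ℝ) (s t : S) : Prop :=
  Relation.ReflTransGen (fun u v => 0 < P u v) s t

/-- Recurrent states of a finite chain: every accessible state leads back. -/
def IsRecurrent {S : Type*} (P : S → S → ℝ) (s : S) : Prop :=
  ∀ t, Reaches P s t → Reaches P t s

/-- A finite chain is unichain if all its recurrent states form one communicating class. -/
def IsUnichain {S : Type*} (P : S → S → ℝ) : Prop :=
  ∀ s t, IsRecurrent P s → IsRecurrent P t → Reaches P s t

open Classical in
/-- `hitTail P t n s` is the probability that the chain with kernel `P` started at `s` has not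
visited `t` at any of the times `0, …, n`, that is `ℙ_s (τ_t > n)` with
`τ_t = min {k ≥ 0 | X_k = t}`. -/
noncomputable def hitTail {S : Type*} [Fintype S] (P : S → S → ℝ) (t : S) : ℕ → S → ℝ
  | 0, s => if s = t then 0 else 1
  | n + 1, s => if s = t then 0 else ∑ u, P s u * hitTail P t n u

/-- Expected time to go from `s` to `t`: `𝔼_s [τ_t] = ∑ n, ℙ_s (τ_t > n)`, possibly infinite. -/
noncomputable def expectedHittingTime {S : Type*} [Fintype S] (P : S → S → ℝ) (s t : S) : ℝ≥0∞ :=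
  ∑' n, ENNReal.ofReal (hitTail P t n s)

/-- The diameter of a chain: the largest expected time to go from any state to a recurrent
state. -/
noncomputable def chainDiam {S : Type*} [Fintype S] (P : S → S → ℝ) : ℝ≥0∞ :=
  ⨆ (s : S) (t : S) (_ : IsRecurrent P t), expectedHittingTime P s t

namespace TwoActionMDP

variable {S : Type*} [Fintype S]

/-- Transition kernel of the chain induced by the deterministic policy `π` (`π s = 1` means that
`s` is activated). -/
def policyKernel (M : TwoActionMDP S) (π : S → Fin 2) : S → S → ℝ :=
  fun s t => M.P (π s) s t

/-- Every deterministic stationary policy induces a unichain Markov chain. -/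
def Unichain (M : TwoActionMDP S) : Prop :=
  ∀ π : S → Fin 2, IsUnichain (M.policyKernel π)

/-- The penalized process `M(lam)`: activating a state costs `lam`. -/
def penalize (M : TwoActionMDP S) (lam : ℝ) : TwoActionMDP S where
  P := M.P
  r := fun a s => M.r a s - if a = 1 then lam else 0
  P_nonneg := M.P_nonneg
  P_sum := M.P_sum

/-- One-step reward of action `a` in state `s` plus the expected continuation value `b`. -/
def qValue (M : TwoActionMDP S) (b : S → ℝ) (a : Fin 2) (s : S) : ℝ :=
  M.r a s + ∑ t, M.P a s t * b t

/-- `g` and `b` are a gain and a bias of the policy `π`: `g + b = r^π + P^π b`. If `P^π` is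
unichain then `g` is unique and `b` is unique up to an additive constant. -/
def IsGainBias (M : TwoActionMDP S) (π : S → Fin 2) (g : ℝ) (b : S → ℝ) : Prop :=
  ∀ s, g + b s = M.qValue b (π s) s

/-- `π` is Bellman optimal: its gain and bias solve the optimality equation
`g + b s = max_a (r a s + ∑ t, P a s t * b t)`. -/
def IsBellmanOptimal (M : TwoActionMDP S) (π : S → Fin 2) : Prop :=
  ∃ g b, M.IsGainBias π g b ∧ ∀ s, IsGreatest (Set.range fun a => M.qValue b a s) (g + b s)

open Classical in
/-- A bias of the policy `π`; only differences of its values matter below, and these do not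
depend on the choice when `P^π` is unichain. -/
noncomputable def bias (M : TwoActionMDP S) (π : S → Fin 2) : S → ℝ :=
  if h : ∃ b, ∃ g, M.IsGainBias π g b then h.choose else 0

/-- Activation advantage of `s` under `π`:
`α_s^π = r^1_s - r^0_s + (P^1_{s,·} - P^0_{s,·}) · b^π`. -/
noncomputable def advantage (M : TwoActionMDP S) (π : S → Fin 2) (s : S) : ℝ :=
  M.r 1 s - M.r 0 s + ∑ t, (M.P 1 s t - M.P 0 s t) * M.bias π t

open Classical in
/-- Optimal activation advantage of `s`: the activation advantage of `s` under a Bellman optimal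
policy. In a unichain MDP such a policy exists, and all of them give the same value. -/
noncomputable def optAdvantage (M : TwoActionMDP S) (s : S) : ℝ :=
  if h : ∃ π, M.IsBellmanOptimal π then M.advantage h.choose s else 0

/-- `M` is indexable: if `x < y` then every Bellman optimal policy of `M(x)` activates all the
states that any Bellman optimal policy of `M(y)` activates. -/
def Indexable (M : TwoActionMDP S) : Prop :=
  ∀ x y : ℝ, x < y → ∀ π π' : S → Fin 2, (M.penalize x).IsBellmanOptimal π →
    (M.penalize y).IsBellmanOptimal π' → ∀ s, π' s = 1 → π s = 1

/-- `l` is the Whittle index of `s`: below the penalty `l` all Bellman optimal policies activate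
`s`, and above it none does. -/
def IsWhittleIndex (M : TwoActionMDP S) (s : S) (l : ℝ) : Prop :=
  (∀ x < l, ∀ π, (M.penalize x).IsBellmanOptimal π → π s = 1) ∧
  (∀ x > l, ∀ π, (M.penalize x).IsBellmanOptimal π → π s = 0)

/-- The transition kernels of both MDPs have the same support. -/
def SameSupport (M N : TwoActionMDP S) : Prop :=
  ∀ a s t, 0 < M.P a s t ↔ 0 < N.P a s t

/-- `‖M - N‖∞` for two MDPs with the same rewards: the maximum over the actions `a` of the
operator norm `‖P^a - Q^a‖∞ = max_s ∑_t |P^a_{s,t} - Q^a_{s,t}|`. -/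
noncomputable def distInf (M N : TwoActionMDP S) : ℝ :=
  ⨆ p : Fin 2 × S, ∑ t, |M.P p.1 p.2 t - N.P p.1 p.2 t|

/-- `N` is a sufficiently accurate estimate of `M`, whose Whittle indices are `lam`:
`‖M - N‖∞ ≤ 1 / max_π D(P^π)`, and `‖M - N‖∞` is at most half of the gap between any two
distinct Whittle indices. -/
def CloseEstimate (M N : TwoActionMDP S) (lam : S → ℝ) : Prop :=
  (∀ π : S → Fin 2, ENNReal.ofReal (M.distInf N) * chainDiam (M.policyKernel π) ≤ 1) ∧
  (∀ s s' : S, lam s ≠ lam s' → M.distInf N ≤ |lam s - lam s'| / 2)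

/-- `M` and `N` have the same unique Bellman optimal policy. -/
def SameUniqueOptimal (M N : TwoActionMDP S) : Prop :=
  ∃ π : S → Fin 2, (∀ π', M.IsBellmanOptimal π' ↔ π' = π) ∧
    (∀ π', N.IsBellmanOptimal π' ↔ π' = π)

end TwoActionMDP

/-!
The proof compares the optimality equations of `M(x)` and of its estimate `N(x)`.

A Lyapunov function `V` for a state `t` (`HitBound`) replaces the potential theory of the chain: by
a maximum principle (`HitBound.sub_le`) every function with average drop at most `K` per step lies
at most `K * D` above its value at `t`. For the unichain process `M` the expected hitting times of a
recurrent state `t` form such a function. If `‖M - N‖∞` times the diameter is at most `1`, then one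
step of `N` instead of `M` changes the expected remaining time by at most `1 / 2`, because the
difference of two transition rows has total mass zero; hence twice the hitting times of `M` serve
as Lyapunov function for `N` (`IsStochastic.hitBound_of_close`). Any two policies have a common
recurrent state (`Unichain.exists_common_recurrent`), so `M` and all its estimates satisfy
`HitBounded` with one constant `D`.

This bound yields solutions of the Poisson equation, a Bellman optimal policy
(`HitBounded.exists_optimal`), and a perturbation estimate for the optimal bias
(`HitBounded.bias_sub_le`). As the optimal biases of all `M(x)` have a common bound, the optimal
advantages of `M(x)` and `N(x)` differ by at most `C * ‖M - N‖∞`, uniformly in `x`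
(`HitBounded.exists_optAdvantage_sub_le`).

The optimal advantage of `M(x)` is continuous and piecewise affine in `x`. It vanishes at most at
the Whittle index: at any other zero there would be optimal policies both activating and resting
`s`. Therefore its absolute value is at least `κ * |x - lam s|`
(`HitBounded.exists_mul_abs_sub_le`). With `c > C / κ`, both optimal advantages have the same sign
once `|x - lam s| > c * ‖M - N‖∞`, and the sign determines the Bellman optimal policy; likewise a
zero of the optimal advantage of `N(x)` cannot be farther than `c * ‖M - N‖∞` from `lam s`.
-/

/-! ### Finite stochastic kernels and Lyapunov functions -/

section Chains

variable {S : Type*} [Fintype S] {P : S → S → ℝ}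

/-- `P` is a stochastic matrix. -/
structure IsStochastic (P : S → S → ℝ) : Prop where
  nonneg : ∀ s t, 0 ≤ P s t
  sum_eq_one : ∀ s, ∑ t, P s t = 1

lemma IsStochastic.sum_mul_le (hP : IsStochastic P) {w : S → ℝ} {m : ℝ} (hw : ∀ u, w u ≤ m)
    (s : S) : ∑ u, P s u * w u ≤ m := by
  calc ∑ u, P s u * w u ≤ ∑ u, P s u * m :=
        Finset.sum_le_sum fun u _ => mul_le_mul_of_nonneg_left (hw u) (hP.nonneg s u)
    _ = m := by rw [← Finset.sum_mul, hP.sum_eq_one, one_mul]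

lemma IsStochastic.le_sum_mul (hP : IsStochastic P) {w : S → ℝ} {m : ℝ} (hw : ∀ u, m ≤ w u)
    (s : S) : m ≤ ∑ u, P s u * w u := by
  calc m = ∑ u, P s u * m := by rw [← Finset.sum_mul, hP.sum_eq_one, one_mul]
    _ ≤ ∑ u, P s u * w u :=
        Finset.sum_le_sum fun u _ => mul_le_mul_of_nonneg_left (hw u) (hP.nonneg s u)

lemma IsStochastic.abs_sum_mul_le (hP : IsStochastic P) {w : S → ℝ} {m : ℝ}
    (hw : ∀ u, |w u| ≤ m) (s : S) : |∑ u, P s u * w u| ≤ m :=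
  abs_le.2 ⟨hP.le_sum_mul (fun u => (abs_le.1 (hw u)).1) s,
    hP.sum_mul_le (fun u => (abs_le.1 (hw u)).2) s⟩

/-- The averages of `w` only involve states where `w` is maximal if they equal the maximum. -/
lemma IsStochastic.eq_of_le_sum_mul (hP : IsStochastic P) {w : S → ℝ} {m : ℝ}
    (hw : ∀ u, w u ≤ m) {s : S} (hs : m ≤ ∑ u, P s u * w u) {v : S} (hv : 0 < P s v) :
    w v = m := by
  by_contra hne
  have hlt : w v < m := lt_of_le_of_ne (hw v) hne
  have : ∑ u, P s u * w u < ∑ u, P s u * m :=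
    Finset.sum_lt_sum (fun u _ => mul_le_mul_of_nonneg_left (hw u) (hP.nonneg s u))
      ⟨v, Finset.mem_univ v, mul_lt_mul_of_pos_left hlt hv⟩
  rw [← Finset.sum_mul, hP.sum_eq_one, one_mul] at this
  linarith

/-- The hitting times of `t` are bounded by `D`, expressed by a Lyapunov function `V`: it lies
between `0` and `D`, vanishes at `t`, and decreases by at least `1` on average in each step made
outside of `t`. -/
def HitBound (P : S → S → ℝ) (t : S) (D : ℝ) : Prop :=
  ∃ V : S → ℝ, V t = 0 ∧ (∀ s, 0 ≤ V s ∧ V s ≤ D) ∧ ∀ s, s ≠ t → 1 + ∑ u, P s u * V u ≤ V s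

lemma HitBound.nonneg {t : S} {D : ℝ} (h : HitBound P t D) : 0 ≤ D := by
  obtain ⟨V, -, hV, -⟩ := h
  exact (hV t).1.trans (hV t).2

/-- Maximum principle: a function that drops by at most `K` per step on average exceeds its
value at `t` by at most `K` times the bound on the time to reach `t`. -/
lemma HitBound.sub_le [Nonempty S] (hP : IsStochastic P) {t : S} {D : ℝ} (h : HitBound P t D)
    {w : S → ℝ} {K : ℝ} (hK : 0 ≤ K) (hw : ∀ s, w s ≤ K + ∑ u, P s u * w u) (s : S) :
    w s - w t ≤ K * D := by
  have hD := h.nonneg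
  obtain ⟨V, hVt, hV, hdrift⟩ := h
  -- With a slope slightly above `K` the drift is strict, so that the maximum has to be at `t`.
  have key : ∀ K' > K, w s - w t ≤ K' * D := by
    intro K' hK'
    obtain ⟨m, hm⟩ := Finite.exists_max fun u => w u - K' * V u
    have hmt : m = t := by
      by_contra hne
      have h1 := hw m
      have h2 := hdrift m hne
      have h3 := hP.sum_mul_le hm m
      simp only [mul_sub, Finset.sum_sub_distrib] at h3
      have h4 : ∑ u, P m u * (K' * V u) = K' * ∑ u, P m u * V u := by
        rw [Finset.mul_sum]; exact Finset.sum_congr rfl fun u _ => by ring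
      rw [h4] at h3
      nlinarith [mul_le_mul_of_nonneg_left h2 (hK.trans hK'.le)]
    have h1 := hm s
    rw [hmt, hVt] at h1
    nlinarith [mul_le_mul_of_nonneg_left (hV s).2 (hK.trans hK'.le)]
  refine le_of_forall_pos_le_add fun ε hε => ?_
  have h1 := key (K + ε / (D + 1)) (by have : 0 < ε / (D + 1) := by positivity
                                       linarith)
  have h2 : ε / (D + 1) * D ≤ ε := by
    rw [div_mul_eq_mul_div, div_le_iff₀ (by linarith)]; nlinarith
  linarith [add_mul K (ε / (D + 1)) D]

lemma HitBound.abs_sub_le [Nonempty S] {Q : S → S → ℝ} (hP : IsStochastic P)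
    (hQ : IsStochastic Q) {t : S} {D : ℝ} (h : HitBound P t D) (h' : HitBound Q t D)
    {w : S → ℝ} {K : ℝ} (hK : 0 ≤ K) (hw : ∀ s, w s ≤ K + ∑ u, P s u * w u)
    (hw' : ∀ s, -K + ∑ u, Q s u * w u ≤ w s) (s : S) : |w s - w t| ≤ K * D := by
  refine abs_le.2 ⟨?_, h.sub_le hP hK hw s⟩
  have := h'.sub_le hQ (w := fun u => -w u) hK (fun u => by
    simp only [mul_neg, Finset.sum_neg_distrib]; linarith [hw' u]) s
  linarith

/-- A chain that reaches `t` in bounded time visits `t` inside every closed set. -/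
lemma HitBound.mem_of_closed (hP : IsStochastic P) {t : S} {D : ℝ} (h : HitBound P t D)
    {C : Set S} (hne : C.Nonempty) (hC : ∀ s ∈ C, ∀ u, 0 < P s u → u ∈ C) : t ∈ C := by
  obtain ⟨V, -, -, hdrift⟩ := h
  by_contra ht
  obtain ⟨m, hmC, hm⟩ := C.toFinite.exists_minimalFor V C hne
  have hmin : ∀ u ∈ C, V m ≤ V u := fun u hu => (le_total (V m) (V u)).elim id fun h => hm hu h
  have h1 := hdrift m fun h => ht (h ▸ hmC)
  have h2 : ∑ u, P m u * V m ≤ ∑ u, P m u * V u := by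
    refine Finset.sum_le_sum fun u _ => ?_
    rcases (hP.nonneg m u).eq_or_lt with h0 | h0
    · simp [← h0]
    · exact mul_le_mul_of_nonneg_left (hmin u (hC m hmC u h0)) h0.le
  rw [← Finset.sum_mul, hP.sum_eq_one, one_mul] at h2
  linarith

/-- A solution of the homogeneous Poisson equation has zero gain and a constant bias. -/
lemma HitBound.poisson_unique [Nonempty S] (hP : IsStochastic P) {t : S} {D : ℝ}
    (h : HitBound P t D) {g : ℝ} {d : S → ℝ} (hd : ∀ s, g + d s = ∑ u, P s u * d u) :
    g = 0 ∧ ∀ s, d s = d t := by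
  obtain ⟨i, hi⟩ := Finite.exists_max d
  obtain ⟨j, hj⟩ := Finite.exists_min d
  have hg : g = 0 := le_antisymm
    (by linarith [hd i, hP.sum_mul_le hi i]) (by linarith [hd j, hP.le_sum_mul hj j])
  refine ⟨hg, fun s => ?_⟩
  have := h.abs_sub_le hP hP h (w := d) le_rfl (fun s => by linarith [hd s])
    (fun s => by linarith [hd s]) s
  rw [zero_mul] at this
  linarith [abs_nonpos_iff.1 this]

/-- The Poisson equation is solvable, because as a square linear system it has a trivial
kernel. -/
lemma HitBound.exists_poisson [Nonempty S] (hP : IsStochastic P) {t : S} {D : ℝ}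
    (h : HitBound P t D) (f : S → ℝ) :
    ∃ (g : ℝ) (b : S → ℝ), ∀ s, g + b s = f s + ∑ u, P s u * b u := by
  let L : (ℝ × (S → ℝ)) →ₗ[ℝ] (ℝ × (S → ℝ)) :=
    { toFun := fun x => (x.2 t, fun s => x.1 + x.2 s - ∑ u, P s u * x.2 u)
      map_add' := fun x y => by
        ext s
        · simp
        · simp only [Prod.fst_add, Prod.snd_add, Pi.add_apply, mul_add, Finset.sum_add_distrib]
          ring
      map_smul' := fun c x => by
        ext s
        · simp
        · simp only [Prod.smul_fst, Prod.smul_snd, Pi.smul_apply, smul_eq_mul, RingHom.id_apply,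
            mul_sub, mul_add, Finset.mul_sum]
          congr 1
          exact Finset.sum_congr rfl fun u _ => by ring }
  have hinj : Function.Injective L := by
    refine (injective_iff_map_eq_zero L).2 fun x hx => ?_
    have hx1 : x.2 t = 0 := congrArg Prod.fst hx
    have hx2 : ∀ s, x.1 + x.2 s - ∑ u, P s u * x.2 u = 0 := fun s =>
      congrFun (congrArg Prod.snd hx) s
    obtain ⟨h1, h2⟩ := h.poisson_unique hP fun s => sub_eq_zero.1 (hx2 s)
    ext s
    · exact h1
    · exact (h2 s).trans hx1
  obtain ⟨x, hx⟩ := LinearMap.injective_iff_surjective.1 hinj (0, f)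
  refine ⟨x.1, x.2, fun s => ?_⟩
  have : x.1 + x.2 s - ∑ u, P s u * x.2 u = f s := congrFun (congrArg Prod.snd hx) s
  linarith

/-! ### Recurrent states and expected hitting times -/

lemma exists_recurrent_of_closed {C : Set S} (hne : C.Nonempty)
    (hC : ∀ s ∈ C, ∀ u, 0 < P s u → u ∈ C) : ∃ t ∈ C, IsRecurrent P t := by
  obtain ⟨t, htC, ht⟩ := C.toFinite.exists_minimalFor (fun s => {u | Reaches P s u}) C hne
  refine ⟨t, htC, fun u hu => ?_⟩
  have huC : u ∈ C := by
    induction hu with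
    | refl => exact htC
    | tail _ h ih => exact hC _ ih _ h
  exact ht huC (fun v (hv : Reaches P u v) => Relation.ReflTransGen.trans hu hv)
    (Relation.ReflTransGen.refl (a := t))

lemma IsRecurrent.of_reaches {S : Type*} {P : S → S → ℝ} {s t : S} (hs : IsRecurrent P s)
    (h : Reaches P s t) : IsRecurrent P t :=
  fun _ hu => Relation.ReflTransGen.trans (hs _ (Relation.ReflTransGen.trans h hu)) h

/-- In a unichain kernel every state reaches every recurrent state. -/
lemma IsUnichain.reaches (h : IsUnichain P) (s : S) {t : S} (ht : IsRecurrent P t) :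
    Reaches P s t := by
  obtain ⟨u, hu, hur⟩ := exists_recurrent_of_closed (P := P) (C := {u | Reaches P s u})
    ⟨s, Relation.ReflTransGen.refl⟩ fun u hu v hv => Relation.ReflTransGen.tail hu hv
  exact Relation.ReflTransGen.trans hu (h u t hur ht)

lemma IsStochastic.le_of_reaches [Nonempty S] (hP : IsStochastic P) {t : S}
    (hr : ∀ s, Reaches P s t) {w : S → ℝ} (hw : ∀ s, s ≠ t → w s ≤ ∑ u, P s u * w u) (s : S) :
    w s ≤ w t := by
  obtain ⟨m, hm⟩ := Finite.exists_max w
  suffices h : ∀ u, Reaches P u t → w u = w m → w t = w m by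
    rw [h m (hr m) rfl]; exact hm s
  intro u hu
  induction hu using Relation.ReflTransGen.head_induction_on with
  | refl => exact id
  | @head a c hac _ ih =>
    intro ha
    by_cases hat : a = t
    · exact hat ▸ ha
    · exact ih (hP.eq_of_le_sum_mul hm (ha ▸ hw a hat) hac)

/-- If `t` can be reached from everywhere, the linear system for the expected hitting times of
`t` has a solution. -/
lemma IsStochastic.exists_hitting_solution [Nonempty S] (hP : IsStochastic P) {t : S}
    (hr : ∀ s, Reaches P s t) :
    ∃ h : S → ℝ, (∀ s, 0 ≤ h s) ∧ ∀ s, s ≠ t → h s = 1 + ∑ u, P s u * h u := by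
  classical
  let L : (S → ℝ) →ₗ[ℝ] (S → ℝ) :=
    { toFun := fun x s => if s = t then x s else x s - ∑ u, P s u * x u
      map_add' := fun x y => by
        ext s
        by_cases hs : s = t
        · simp [hs]
        · simp only [hs, if_false, Pi.add_apply, mul_add, Finset.sum_add_distrib]
          ring
      map_smul' := fun c x => by
        ext s
        by_cases hs : s = t
        · simp [hs]
        · simp only [hs, if_false, Pi.smul_apply, smul_eq_mul, RingHom.id_apply, mul_sub,
            Finset.mul_sum]
          congr 1
          exact Finset.sum_congr rfl fun u _ => by ring }
  have hLt : ∀ x, L x t = x t := fun x => if_pos rfl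
  have hLs : ∀ x s, s ≠ t → L x s = x s - ∑ u, P s u * x u := fun x s hs => if_neg hs
  have hinj : Function.Injective L := by
    refine (injective_iff_map_eq_zero L).2 fun x hx => ?_
    have hxt : x t = 0 := by rw [← hLt x, hx]; rfl
    have hxs : ∀ s, s ≠ t → x s = ∑ u, P s u * x u := fun s hs => by
      rw [← sub_eq_zero, ← hLs x s hs, hx]; rfl
    ext s
    have h1 := hP.le_of_reaches hr (w := x) (fun s hs => (hxs s hs).le) s
    have h2 := hP.le_of_reaches hr (w := fun u => -x u) (fun s hs => by
      simp only [mul_neg, Finset.sum_neg_distrib]; rw [← hxs s hs]) s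
    simp only [Pi.zero_apply]
    linarith
  obtain ⟨h, hh⟩ := LinearMap.injective_iff_surjective.1 hinj fun s => if s = t then 0 else 1
  have hht : h t = 0 := by rw [← hLt h, hh]; simp
  have hhs : ∀ s, s ≠ t → h s = 1 + ∑ u, P s u * h u := fun s hs => by
    have := hLs h s hs
    rw [hh] at this
    simp only [hs, if_false] at this
    linarith
  refine ⟨h, fun s => ?_, hhs⟩
  have h2 := hP.le_of_reaches hr (w := fun u => -h u) (fun s hs => by
    simp only [mul_neg, Finset.sum_neg_distrib]; linarith [hhs s hs]) s
  linarith

@[simp] lemma hitTail_self (t : S) (n : ℕ) : hitTail P t n t = 0 := by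
  cases n <;> simp [hitTail]

lemma hitTail_succ {s t : S} (hs : s ≠ t) (n : ℕ) :
    hitTail P t (n + 1) s = ∑ u, P s u * hitTail P t n u := by
  simp [hitTail, hs]

lemma IsStochastic.hitTail_nonneg (hP : IsStochastic P) (t : S) (n : ℕ) (s : S) :
    0 ≤ hitTail P t n s := by
  induction n generalizing s with
  | zero => by_cases hs : s = t <;> simp [hitTail, hs]
  | succ n ih =>
    by_cases hs : s = t
    · simp [hs]
    · rw [hitTail_succ hs]
      exact Finset.sum_nonneg fun u _ => mul_nonneg (hP.nonneg s u) (ih u)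

lemma IsStochastic.summable_hitTail [Nonempty S] (hP : IsStochastic P) {t : S}
    (hr : ∀ s, Reaches P s t) (s : S) : Summable fun n => hitTail P t n s := by
  obtain ⟨h, h0, hh⟩ := hP.exists_hitting_solution hr
  refine summable_of_sum_range_le (c := h s) (fun n => hP.hitTail_nonneg t n s) fun k => ?_
  induction k generalizing s with
  | zero => simpa using h0 s
  | succ k ih =>
    by_cases hs : s = t
    · simp [hs, h0 t]
    · rw [Finset.sum_range_succ', hh s hs]
      simp only [hitTail_succ hs]
      rw [Finset.sum_comm]
      simp only [← Finset.mul_sum]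
      have : hitTail P t 0 s = 1 := by simp [hitTail, hs]
      rw [this, add_comm]
      gcongr with u _
      · exact hP.nonneg s u
      · exact ih u

/-- The expected hitting time of `t` as a real number. -/
noncomputable def hitTime (P : S → S → ℝ) (t s : S) : ℝ := ∑' n, hitTail P t n s

@[simp] lemma hitTime_self (t : S) : hitTime P t t = 0 := by simp [hitTime]

lemma IsStochastic.hitTime_nonneg (hP : IsStochastic P) (t s : S) : 0 ≤ hitTime P t s :=
  tsum_nonneg fun n => hP.hitTail_nonneg t n s

lemma IsStochastic.hitTime_eq [Nonempty S] (hP : IsStochastic P) {t : S}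
    (hr : ∀ s, Reaches P s t) {s : S} (hs : s ≠ t) :
    hitTime P t s = 1 + ∑ u, P s u * hitTime P t u := by
  have hsum := hP.summable_hitTail hr
  rw [hitTime, (hsum s).tsum_eq_zero_add]
  have : hitTail P t 0 s = 1 := by simp [hitTail, hs]
  rw [this]
  simp only [hitTail_succ hs, hitTime]
  rw [Summable.tsum_finsetSum fun u _ => (hsum u).mul_left _]
  simp only [tsum_mul_left]

lemma IsStochastic.ofReal_hitTime [Nonempty S] (hP : IsStochastic P) {t : S}
    (hr : ∀ s, Reaches P s t) (s : S) :
    ENNReal.ofReal (hitTime P t s) = expectedHittingTime P s t :=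
  ENNReal.ofReal_tsum_of_nonneg (fun n => hP.hitTail_nonneg t n s) (hP.summable_hitTail hr s)

/-- If `ε` is at most the inverse diameter of `P` and `Q` is within `ε` of `P`, then twice the
expected hitting time of `P` is a Lyapunov function for `Q`. -/
lemma IsStochastic.hitBound_of_close [Nonempty S] (hP : IsStochastic P) {Q : S → S → ℝ}
    (hQ : IsStochastic Q) (hu : IsUnichain P) {t : S} (ht : IsRecurrent P t) {D ε : ℝ}
    (hD : ∀ s, hitTime P t s ≤ D) (hε : ENNReal.ofReal ε * chainDiam P ≤ 1)
    (hPQ : ∀ s, ∑ u, |P s u - Q s u| ≤ ε) : HitBound Q t (2 * D) := by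
  have hr : ∀ s, Reaches P s t := fun s => hu.reaches s ht
  have hε0 : 0 ≤ ε := (Finset.sum_nonneg fun u _ => abs_nonneg _).trans (hPQ t)
  have hle : ∀ s, ε * hitTime P t s ≤ 1 := by
    intro s
    have h1 : ENNReal.ofReal (hitTime P t s) ≤ chainDiam P := by
      rw [hP.ofReal_hitTime hr]
      exact le_iSup_of_le s (le_iSup_of_le t (le_iSup_of_le ht le_rfl))
    have h2 : ENNReal.ofReal (ε * hitTime P t s) ≤ 1 := by
      rw [ENNReal.ofReal_mul hε0]
      exact (mul_le_mul_right h1 _).trans hε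
    exact ENNReal.ofReal_le_one.1 h2
  have hdiff : ∀ s, ∑ u, Q s u * hitTime P t u ≤ ∑ u, P s u * hitTime P t u + 1 / 2 := by
    intro s
    rcases hε0.eq_or_lt with h0 | h0
    · have : ∀ u, Q s u = P s u := fun u => by
        have h1 := (Finset.single_le_sum (f := fun u => |P s u - Q s u|)
          (fun u _ => abs_nonneg _) (Finset.mem_univ u)).trans (hPQ s)
        rw [← h0] at h1
        linarith [abs_nonpos_iff.1 h1]
      simp only [this]
      linarith
    · -- The rows of `Q - P` sum to zero, so the hitting times may be centred before estimating.
      have h1 : ε * (∑ u, Q s u * hitTime P t u - ∑ u, P s u * hitTime P t u)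
          = ∑ u, (Q s u - P s u) * (ε * hitTime P t u - 1 / 2) := by
        simp only [mul_sub, sub_mul, Finset.sum_sub_distrib, ← Finset.sum_mul, hP.sum_eq_one,
          hQ.sum_eq_one, Finset.mul_sum, mul_left_comm ε]
        ring
      have h2 : ∑ u, (Q s u - P s u) * (ε * hitTime P t u - 1 / 2)
          ≤ ∑ u, |P s u - Q s u| * (1 / 2) := by
        refine Finset.sum_le_sum fun u _ => (le_abs_self _).trans ?_
        rw [abs_mul, abs_sub_comm]
        refine mul_le_mul_of_nonneg_left (abs_le.2 ⟨?_, ?_⟩) (abs_nonneg _)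
        · linarith [mul_nonneg hε0 (hP.hitTime_nonneg t u)]
        · linarith [hle u]
      rw [← Finset.sum_mul] at h2
      have h3 : ε * (∑ u, Q s u * hitTime P t u - ∑ u, P s u * hitTime P t u) ≤ ε * (1 / 2) := by
        linarith [hPQ s]
      linarith [le_of_mul_le_mul_left h3 h0]
  refine ⟨fun s => 2 * hitTime P t s, by simp, fun s => ⟨?_, ?_⟩, fun s hs => ?_⟩
  · linarith [hP.hitTime_nonneg t s]
  · linarith [hD s]
  · have h1 := hP.hitTime_eq hr hs
    have h2 := hdiff s
    simp only [mul_left_comm _ (2 : ℝ), ← Finset.mul_sum]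
    linarith

end Chains

namespace TwoActionMDP

variable {S : Type*} [Fintype S] {M N : TwoActionMDP S}

/-! ### Optimality equation and its perturbation -/

lemma isStochastic (M : TwoActionMDP S) (π : S → Fin 2) : IsStochastic (M.policyKernel π) :=
  ⟨fun s t => M.P_nonneg (π s) s t, fun s => M.P_sum (π s) s⟩

lemma isStochastic_P (M : TwoActionMDP S) (a : Fin 2) : IsStochastic (M.P a) :=
  ⟨M.P_nonneg a, M.P_sum a⟩

/-- Any two policies have a common state which both of them reach in a time bounded by `D`. This
is the quantitative form of the unichain property on which the arguments below are based. -/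
def HitBounded (M : TwoActionMDP S) (D : ℝ) : Prop :=
  ∀ π π' : S → Fin 2, ∃ t, HitBound (M.policyKernel π) t D ∧ HitBound (M.policyKernel π') t D

lemma HitBounded.penalize {D : ℝ} (h : M.HitBounded D) (x : ℝ) : (M.penalize x).HitBounded D := h

/-- `g` and `b` are the gain and the bias of `π` and solve the optimality equation. -/
def IsOptimalTriple (M : TwoActionMDP S) (π : S → Fin 2) (g : ℝ) (b : S → ℝ) : Prop :=
  M.IsGainBias π g b ∧ ∀ s a, M.qValue b a s ≤ g + b s

lemma isBellmanOptimal_iff {π : S → Fin 2} :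
    M.IsBellmanOptimal π ↔ ∃ g b, M.IsOptimalTriple π g b := by
  refine exists_congr fun g => exists_congr fun b => and_congr_right fun h =>
    forall_congr' fun s => ?_
  constructor
  · rintro h1 a
    exact h1.2 ⟨a, rfl⟩
  · intro h1
    refine ⟨⟨π s, (h s).symm⟩, ?_⟩
    rintro _ ⟨a, rfl⟩
    exact h1 a

/-- The activation advantage computed with the continuation value `b`. -/
def adv (M : TwoActionMDP S) (b : S → ℝ) (s : S) : ℝ := M.qValue b 1 s - M.qValue b 0 s

lemma adv_eq (b : S → ℝ) (s : S) :
    M.adv b s = M.r 1 s - M.r 0 s + ∑ t, (M.P 1 s t - M.P 0 s t) * b t := by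
  simp only [adv, qValue, sub_mul, Finset.sum_sub_distrib]
  ring

lemma qValue_eq_add (b b' : S → ℝ) (a : Fin 2) (s : S) :
    M.qValue b' a s = M.qValue b a s + ∑ t, M.P a s t * (b' t - b t) := by
  simp only [qValue, mul_sub, Finset.sum_sub_distrib]
  ring

lemma qValue_add_const {b b' : S → ℝ} {k : ℝ} (h : ∀ s, b' s = b s + k) (a : Fin 2) (s : S) :
    M.qValue b' a s = M.qValue b a s + k := by
  rw [qValue_eq_add b b']
  simp only [h, add_sub_cancel_left, ← Finset.sum_mul, M.P_sum, one_mul]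

lemma qValue_penalize (x : ℝ) (b : S → ℝ) (a : Fin 2) (s : S) :
    (M.penalize x).qValue b a s = M.qValue b a s - if a = 1 then x else 0 := by
  simp only [qValue, TwoActionMDP.penalize]
  ring

lemma adv_penalize (x : ℝ) (b : S → ℝ) (s : S) : (M.penalize x).adv b s = M.adv b s - x := by
  simp only [adv, qValue_penalize]
  simp
  ring

/-- An optimal policy follows the sign of the advantage. -/
lemma IsGainBias.isOptimalTriple_iff {π : S → Fin 2} {g : ℝ} {b : S → ℝ}
    (h : M.IsGainBias π g b) :
    M.IsOptimalTriple π g b ↔ ∀ s, (π s = 1 → 0 ≤ M.adv b s) ∧ (π s = 0 → M.adv b s ≤ 0) := by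
  rw [IsOptimalTriple, and_iff_right h]
  refine forall_congr' fun s => ?_
  have hs := h s
  rw [Fin.forall_fin_two, hs, adv]
  have : π s = 0 ∨ π s = 1 := by omega
  rcases this with h0 | h0 <;> simp [h0]

variable [Nonempty S]

/-- Perturbation of the optimal bias: if all state-action values of `M` and `N` at an optimal bias
`b` of `M` agree up to `η`, then the optimal biases differ, up to a constant, by at most
`2 * η * D`. The two policies give a lower and an upper estimate; they can be combined because
both policies have a common recurrent state. -/
lemma HitBounded.bias_sub_le {D η : ℝ} (hN : N.HitBounded D) {π π' : S → Fin 2} {g g' : ℝ}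
    {b b' : S → ℝ} (h : M.IsOptimalTriple π g b) (h' : N.IsOptimalTriple π' g' b')
    (hη : ∀ a s, |N.qValue b a s - M.qValue b a s| ≤ η) :
    ∃ t, ∀ s, |(b' s - b s) - (b' t - b t)| ≤ 2 * η * D := by
  obtain ⟨t, ht, ht'⟩ := hN π π'
  have hη0 : 0 ≤ η := (abs_nonneg _).trans (hη 0 t)
  have lower : ∀ s, (g' - g) + (b' s - b s)
      ≥ -η + ∑ u, N.policyKernel π s u * (b' u - b u) := fun s => by
    have h1 := h'.2 s (π s)
    rw [qValue_eq_add b b'] at h1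
    have h2 := h.1 s
    have h3 := (abs_le.1 (hη (π s) s)).1
    simp only [policyKernel]
    linarith
  have upper : ∀ s, (g' - g) + (b' s - b s)
      ≤ η + ∑ u, N.policyKernel π' s u * (b' u - b u) := fun s => by
    have h1 := h'.1 s
    rw [qValue_eq_add b b'] at h1
    have h2 := h.2 s (π' s)
    have h3 := (abs_le.1 (hη (π' s) s)).2
    simp only [policyKernel]
    linarith
  obtain ⟨i, hi⟩ := Finite.exists_max fun s => b' s - b s
  obtain ⟨j, hj⟩ := Finite.exists_min fun s => b' s - b s
  have hg1 : g' - g ≤ η := by linarith [upper i, (N.isStochastic π').sum_mul_le hi i]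
  have hg2 : -η ≤ g' - g := by linarith [lower j, (N.isStochastic π).le_sum_mul hj j]
  exact ⟨t, fun s => ht'.abs_sub_le (N.isStochastic π') (N.isStochastic π) ht
    (w := fun s => b' s - b s) (by linarith) (fun s => by linarith [upper s])
    (fun s => by linarith [lower s]) s⟩

lemma HitBounded.adv_sub_le {D η : ℝ} (hN : N.HitBounded D) {π π' : S → Fin 2} {g g' : ℝ}
    {b b' : S → ℝ} (h : M.IsOptimalTriple π g b) (h' : N.IsOptimalTriple π' g' b')
    (hη : ∀ a s, |N.qValue b a s - M.qValue b a s| ≤ η) (s : S) :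
    |N.adv b' s - M.adv b s| ≤ (2 + 4 * D) * η := by
  obtain ⟨t, ht⟩ := hN.bias_sub_le h h' hη
  have e : ∀ a, N.qValue b' a s = N.qValue b a s + (b' t - b t)
      + ∑ u, N.P a s u * ((b' u - b u) - (b' t - b t)) := fun a => by
    rw [qValue_eq_add b b']
    simp only [mul_sub _ _ (b' t - b t), Finset.sum_sub_distrib, ← Finset.sum_mul, N.P_sum]
    ring
  have h1 := abs_le.1 ((N.isStochastic_P 1).abs_sum_mul_le ht s)
  have h0 := abs_le.1 ((N.isStochastic_P 0).abs_sum_mul_le ht s)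
  have k1 := abs_le.1 (hη 1 s)
  have k0 := abs_le.1 (hη 0 s)
  rw [adv, adv, e 1, e 0, abs_le]
  constructor <;> linarith [h1.1, h1.2, h0.1, h0.2, k1.1, k1.2, k0.1, k0.2]

lemma HitBounded.exists_isGainBias {D : ℝ} (hM : M.HitBounded D) (π : S → Fin 2) :
    ∃ g b, M.IsGainBias π g b := by
  obtain ⟨t, ht, -⟩ := hM π π
  exact ht.exists_poisson (M.isStochastic π) fun s => M.r (π s) s

lemma HitBounded.isGainBias_unique {D : ℝ} (hM : M.HitBounded D) {π : S → Fin 2} {g g' : ℝ}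
    {b b' : S → ℝ} (h : M.IsGainBias π g b) (h' : M.IsGainBias π g' b') :
    g' = g ∧ ∃ k, ∀ s, b' s = b s + k := by
  obtain ⟨t, ht, -⟩ := hM π π
  obtain ⟨h1, h2⟩ := ht.poisson_unique (M.isStochastic π) (g := g' - g) (d := fun s => b' s - b s)
    fun s => by
      have e := h' s
      rw [qValue_eq_add b b'] at e
      simp only [policyKernel]
      linarith [h s]
  exact ⟨sub_eq_zero.1 h1, b' t - b t, fun s => by linarith [h2 s]⟩

/-- The optimal advantage can be computed from any solution of the optimality equation. -/
lemma HitBounded.optAdvantage_eq {D : ℝ} (hM : M.HitBounded D) {π : S → Fin 2} {g : ℝ}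
    {b : S → ℝ} (h : M.IsOptimalTriple π g b) (s : S) : M.optAdvantage s = M.adv b s := by
  have hex : ∃ π, M.IsBellmanOptimal π := ⟨π, isBellmanOptimal_iff.2 ⟨g, b, h⟩⟩
  rw [optAdvantage, dif_pos hex, advantage, ← adv_eq]
  obtain ⟨g', b', h'⟩ := isBellmanOptimal_iff.1 hex.choose_spec
  have hb : ∃ b g, M.IsGainBias hex.choose g b := ⟨b', g', h'.1⟩
  have e : M.bias hex.choose = hb.choose := dif_pos hb
  obtain ⟨g'', hg''⟩ := hb.choose_spec
  rw [← e] at hg''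
  obtain ⟨-, k, hk⟩ := hM.isGainBias_unique h'.1 hg''
  have h2 := hM.adv_sub_le h h' (η := 0) (by simp) s
  rw [mul_zero] at h2
  have h3 : M.adv (M.bias hex.choose) s = M.adv b' s := by
    simp only [adv, qValue_add_const hk]
    ring
  linarith [abs_nonpos_iff.1 h2]

/-- A Bellman optimal policy exists. The proof is by induction on the set `A` of states in which
both actions are allowed. If neither action in the additional state `z` gave an optimal
policy, then the difference `d` of the two biases would be constant: its maximum is attained on a
set that is closed under the one policy, its minimum on a set that is closed under the other
one, and both sets contain the common recurrent state. -/
lemma HitBounded.exists_optimal {D : ℝ} (hM : M.HitBounded D) :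
    ∃ π g b, M.IsOptimalTriple π g b := by
  classical
  suffices H : ∀ (A : Finset S) (σ : S → Fin 2), ∃ π g b, M.IsGainBias π g b ∧
      (∀ s ∉ A, π s = σ s) ∧ ∀ s ∈ A, ∀ a, M.qValue b a s ≤ g + b s by
    obtain ⟨π, g, b, h1, -, h2⟩ := H Finset.univ 0
    exact ⟨π, g, b, h1, fun s => h2 s (Finset.mem_univ s)⟩
  intro A
  induction A using Finset.induction_on with
  | empty =>
    intro σ
    obtain ⟨g, b, h⟩ := hM.exists_isGainBias σ
    exact ⟨σ, g, b, h, fun _ _ => rfl, by simp⟩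
  | insert z A hz ih =>
    intro σ
    obtain ⟨π₀, g₀, b₀, h₀, hσ₀, ho₀⟩ := ih (Function.update σ z 0)
    obtain ⟨π₁, g₁, b₁, h₁, hσ₁, ho₁⟩ := ih (Function.update σ z 1)
    have hz₀ : π₀ z = 0 := by simpa using hσ₀ z hz
    have hz₁ : π₁ z = 1 := by simpa using hσ₁ z hz
    have hne : ∀ s ∉ insert z A, s ≠ z ∧ s ∉ A := fun s hs => by simpa using hs
    have hs₀ : ∀ s ∉ insert z A, π₀ s = σ s := fun s hs => by
      rw [hσ₀ s (hne s hs).2, Function.update_of_ne (hne s hs).1]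
    have hs₁ : ∀ s ∉ insert z A, π₁ s = σ s := fun s hs => by
      rw [hσ₁ s (hne s hs).2, Function.update_of_ne (hne s hs).1]
    by_cases c₀ : M.qValue b₀ 1 z ≤ g₀ + b₀ z
    · refine ⟨π₀, g₀, b₀, h₀, hs₀, fun s hs => ?_⟩
      rcases Finset.mem_insert.1 hs with rfl | hs
      · rw [Fin.forall_fin_two]
        exact ⟨(hz₀ ▸ h₀ s).ge, c₀⟩
      · exact ho₀ s hs
    by_cases c₁ : M.qValue b₁ 0 z ≤ g₁ + b₁ z
    · refine ⟨π₁, g₁, b₁, h₁, hs₁, fun s hs => ?_⟩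
      rcases Finset.mem_insert.1 hs with rfl | hs
      · rw [Fin.forall_fin_two]
        exact ⟨c₁, (hz₁ ▸ h₁ s).ge⟩
      · exact ho₁ s hs
    exfalso
    push Not at c₀ c₁
    let d : S → ℝ := fun s => b₁ s - b₀ s
    -- Away from `z` each policy is admissible in the optimality equation of the other one.
    have lower : ∀ s, s ≠ z → ∑ u, M.policyKernel π₀ s u * d u ≤ (g₁ - g₀) + d s := fun s hs => by
      have h1 : M.qValue b₁ (π₀ s) s ≤ g₁ + b₁ s := by
        by_cases hA : s ∈ A
        · exact ho₁ s hA _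
        · have : s ∉ insert z A := by simp [hs, hA]
          rw [hs₀ s this, ← hs₁ s this]
          exact (h₁ s).ge
      rw [qValue_eq_add b₀ b₁] at h1
      simp only [policyKernel, d]
      linarith [h₀ s]
    have upper : ∀ s, s ≠ z → (g₁ - g₀) + d s ≤ ∑ u, M.policyKernel π₁ s u * d u := fun s hs => by
      have h1 : M.qValue b₀ (π₁ s) s ≤ g₀ + b₀ s := by
        by_cases hA : s ∈ A
        · exact ho₀ s hA _
        · have : s ∉ insert z A := by simp [hs, hA]
          rw [hs₁ s this, ← hs₀ s this]
          exact (h₀ s).ge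
      have e := h₁ s
      rw [qValue_eq_add b₀ b₁] at e
      simp only [policyKernel, d]
      linarith
    have lower_z : (g₁ - g₀) + d z < ∑ u, M.policyKernel π₀ z u * d u := by
      rw [qValue_eq_add b₀ b₁] at c₁
      have e := h₀ z
      rw [hz₀] at e
      simp only [policyKernel, d, hz₀]
      linarith
    have upper_z : ∑ u, M.policyKernel π₁ z u * d u < (g₁ - g₀) + d z := by
      have e := h₁ z
      rw [hz₁, qValue_eq_add b₀ b₁] at e
      simp only [policyKernel, d, hz₁]
      linarith
    obtain ⟨i, hi⟩ := Finite.exists_max d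
    obtain ⟨j, hj⟩ := Finite.exists_min d
    have hi' := (M.isStochastic π₀).sum_mul_le hi z
    have hj' := (M.isStochastic π₁).le_sum_mul hj z
    have hg : g₁ - g₀ = 0 := by
      apply le_antisymm
      · by_cases hiz : i = z
        · rw [hiz] at hi'; linarith
        · linarith [upper i hiz, (M.isStochastic π₁).sum_mul_le hi i]
      · by_cases hjz : j = z
        · rw [hjz] at hj'; linarith
        · linarith [lower j hjz, (M.isStochastic π₀).le_sum_mul hj j]
    rw [hg, zero_add] at lower_z upper_z
    obtain ⟨t, ht₀, ht₁⟩ := hM π₀ π₁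
    have hti : t ∈ {s | d s = d i} := by
      refine ht₁.mem_of_closed (M.isStochastic π₁) ⟨i, rfl⟩ fun s hs u hu => ?_
      have hs : d s = d i := hs
      have hsz : s ≠ z := by rintro rfl; linarith
      exact (M.isStochastic π₁).eq_of_le_sum_mul hi (by linarith [upper s hsz]) hu
    have htj : t ∈ {s | d s = d j} := by
      refine ht₀.mem_of_closed (M.isStochastic π₀) ⟨j, rfl⟩ fun s hs u hu => ?_
      have hs : d s = d j := hs
      have hsz : s ≠ z := by rintro rfl; linarith
      have := (M.isStochastic π₀).eq_of_le_sum_mul (w := fun u => -d u) (m := -d j)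
        (fun u => neg_le_neg (hj u)) (s := s)
        (by simp only [mul_neg, Finset.sum_neg_distrib]; linarith [lower s hsz]) hu
      exact neg_inj.1 this
    have hti : d t = d i := hti
    have htj : d t = d j := htj
    linarith [hj z]

/-- The Bellman optimal policies are exactly those that follow the sign of the optimal
advantage. -/
lemma HitBounded.isBellmanOptimal_iff_sign {D : ℝ} (hM : M.HitBounded D) {π : S → Fin 2} :
    M.IsBellmanOptimal π ↔
      ∀ s, (π s = 1 → 0 ≤ M.optAdvantage s) ∧ (π s = 0 → M.optAdvantage s ≤ 0) := by
  constructor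
  · intro h
    obtain ⟨g, b, h⟩ := isBellmanOptimal_iff.1 h
    simp only [hM.optAdvantage_eq h]
    exact h.1.isOptimalTriple_iff.1 h
  · intro h
    obtain ⟨σ, g, b, hσ⟩ := hM.exists_optimal
    simp only [hM.optAdvantage_eq hσ] at h
    have hπ : M.IsGainBias π g b := fun s => by
      have h0 := hσ.2 s
      have h1 := hσ.1 s
      have : π s = σ s ∨ (π s = 1 ∧ σ s = 0) ∨ (π s = 0 ∧ σ s = 1) := by omega
      rcases this with e | ⟨e, e'⟩ | ⟨e, e'⟩
      · rw [e, h1]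
      · have := (h s).1 e
        rw [e'] at h1
        rw [adv] at this
        rw [e]
        exact le_antisymm (by linarith) (h0 1)
      · have := (h s).2 e
        rw [e'] at h1
        rw [adv] at this
        rw [e]
        exact le_antisymm (by linarith) (h0 0)
    exact isBellmanOptimal_iff.2 ⟨g, b, hπ.isOptimalTriple_iff.2 h⟩

/-- Two processes whose optimal advantages are nonzero and have the same signs have the same
unique optimal policy. -/
lemma HitBounded.sameUniqueOptimal {D D' : ℝ} (hM : M.HitBounded D) (hN : N.HitBounded D')
    (h : ∀ s, |M.optAdvantage s - N.optAdvantage s| < |M.optAdvantage s|) :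
    M.SameUniqueOptimal N := by
  classical
  have key : ∀ L : TwoActionMDP S, (∀ s, (0 < M.optAdvantage s ∧ 0 < L.optAdvantage s) ∨
      (M.optAdvantage s < 0 ∧ L.optAdvantage s < 0)) → ∀ {E : ℝ}, L.HitBounded E → ∀ π,
      L.IsBellmanOptimal π ↔ π = fun s => if 0 < M.optAdvantage s then 1 else 0 := by
    intro L hL E hE π
    rw [hE.isBellmanOptimal_iff_sign, funext_iff]
    refine forall_congr' fun s => ?_
    have : π s = 0 ∨ π s = 1 := by omega
    rcases hL s with ⟨h1, h2⟩ | ⟨h1, h2⟩ <;> rcases this with e | e <;>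
      simp [e, h1, h2.le, h1.not_gt, h2.not_ge]
  refine ⟨_, key M (fun s => ?_) hM, key N (fun s => ?_) hN⟩
  · have := abs_pos.1 ((abs_nonneg _).trans_lt (h s))
    rcases this.lt_or_gt with h1 | h1
    · exact Or.inr ⟨h1, h1⟩
    · exact Or.inl ⟨h1, h1⟩
  · have hs := h s
    have := abs_pos.1 ((abs_nonneg _).trans_lt hs)
    rcases this.lt_or_gt with h1 | h1
    · rw [abs_of_neg h1, abs_lt] at hs
      exact Or.inr ⟨h1, by linarith [hs.1]⟩
    · rw [abs_of_pos h1, abs_lt] at hs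
      exact Or.inl ⟨h1, by linarith [hs.2]⟩

end TwoActionMDP

namespace TwoActionMDP

variable {S : Type*} [Fintype S] {M N : TwoActionMDP S}

/-! ### Unichain processes and their estimates -/

/-- Otherwise the policy that follows `π` on the recurrent states of `π`, and `π'` elsewhere, would
have two recurrent classes. -/
lemma Unichain.exists_common_recurrent [Nonempty S] (hM : M.Unichain) (π π' : S → Fin 2) :
    ∃ t, IsRecurrent (M.policyKernel π) t ∧ IsRecurrent (M.policyKernel π') t := by
  classical
  by_contra! hdisj
  let σ : S → Fin 2 := fun s => if IsRecurrent (M.policyKernel π) s then π s else π' s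
  have closed : ∀ s, IsRecurrent (M.policyKernel π) s → ∀ u, 0 < M.policyKernel σ s u →
      IsRecurrent (M.policyKernel π) u := fun s hs u hu => by
    refine hs.of_reaches (Relation.ReflTransGen.single ?_)
    simpa [policyKernel, σ, hs] using hu
  have closed' : ∀ s, IsRecurrent (M.policyKernel π') s → ∀ u, 0 < M.policyKernel σ s u →
      IsRecurrent (M.policyKernel π') u := fun s hs u hu => by
    have hs' : ¬ IsRecurrent (M.policyKernel π) s := fun h => hdisj s h hs
    refine hs.of_reaches (Relation.ReflTransGen.single ?_)
    simpa [policyKernel, σ, hs'] using hu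
  have nonempty : ∀ τ, {s | IsRecurrent (M.policyKernel τ) s}.Nonempty := fun τ => by
    obtain ⟨t, -, ht⟩ := exists_recurrent_of_closed (P := M.policyKernel τ) (C := Set.univ)
      Set.univ_nonempty fun _ _ _ _ => trivial
    exact ⟨t, ht⟩
  obtain ⟨u, hu, hur⟩ := exists_recurrent_of_closed (nonempty π) closed
  obtain ⟨v, hv, hvr⟩ := exists_recurrent_of_closed (nonempty π') closed'
  have huv := hM σ u v hur hvr
  have : ∀ w, Reaches (M.policyKernel σ) u w → IsRecurrent (M.policyKernel π) w := fun w hw => by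
    induction hw with
    | refl => exact hu
    | tail _ h ih => exact closed _ ih _ h
  exact hdisj v (this v huv) hv

lemma sum_abs_sub_le_distInf (M N : TwoActionMDP S) (a : Fin 2) (s : S) :
    ∑ t, |M.P a s t - N.P a s t| ≤ M.distInf N :=
  le_ciSup (f := fun p : Fin 2 × S => ∑ t, |M.P p.1 p.2 t - N.P p.1 p.2 t|)
    (Set.finite_range _).bddAbove (a, s)

lemma distInf_nonneg (M N : TwoActionMDP S) : 0 ≤ M.distInf N :=
  Real.iSup_nonneg fun _ => Finset.sum_nonneg fun _ _ => abs_nonneg _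

lemma distInf_le_two [Nonempty S] (M N : TwoActionMDP S) : M.distInf N ≤ 2 := by
  refine ciSup_le fun p => ?_
  calc ∑ t, |M.P p.1 p.2 t - N.P p.1 p.2 t| ≤ ∑ t, (M.P p.1 p.2 t + N.P p.1 p.2 t) :=
        Finset.sum_le_sum fun t _ => abs_le.2
          ⟨by linarith [M.P_nonneg p.1 p.2 t, N.P_nonneg p.1 p.2 t],
            by linarith [M.P_nonneg p.1 p.2 t, N.P_nonneg p.1 p.2 t]⟩
    _ = 2 := by rw [Finset.sum_add_distrib, M.P_sum, N.P_sum]; norm_num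

lemma distInf_self [Nonempty S] (M : TwoActionMDP S) : M.distInf M = 0 := by
  simp [distInf]

/-- All estimates of a unichain process whose distance is at most the inverse of the largest
diameter satisfy a common bound on the hitting times. -/
lemma Unichain.exists_hitBounded [Nonempty S] (hM : M.Unichain) : ∃ D, ∀ N : TwoActionMDP S,
    (∀ π : S → Fin 2, ENNReal.ofReal (M.distInf N) * chainDiam (M.policyKernel π) ≤ 1) →
      N.HitBounded D := by
  obtain ⟨D, hD⟩ := (Set.finite_range fun p : (S → Fin 2) × S × S =>
    hitTime (M.policyKernel p.1) p.2.1 p.2.2).bddAbove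
  refine ⟨2 * D, fun N hN π π' => ?_⟩
  obtain ⟨t, ht, ht'⟩ := hM.exists_common_recurrent π π'
  have key : ∀ τ, IsRecurrent (M.policyKernel τ) t → HitBound (N.policyKernel τ) t (2 * D) :=
    fun τ hτ => (M.isStochastic τ).hitBound_of_close (N.isStochastic τ) (hM τ) hτ
      (fun s => hD ⟨(τ, t, s), rfl⟩) (hN τ) fun s => M.sum_abs_sub_le_distInf N (τ s) s
  exact ⟨t, key π ht, key π' ht'⟩

/-! ### The optimal advantage as a function of the penalty -/

variable [Nonempty S]

lemma HitBounded.exists_optimal_penalize {D : ℝ} (hM : M.HitBounded D) (x : ℝ) :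
    ∃ π g b, (M.penalize x).IsOptimalTriple π g b :=
  (hM.penalize x).exists_optimal

lemma HitBounded.continuous_optAdvantage {D : ℝ} (hM : M.HitBounded D) (s : S) :
    Continuous fun x => (M.penalize x).optAdvantage s := by
  have hD : 0 ≤ D := by
    obtain ⟨t, ht, -⟩ := hM 0 0
    exact ht.nonneg
  refine (LipschitzWith.of_dist_le_mul (K := ⟨2 + 4 * D, by positivity⟩) fun x y => ?_).continuous
  obtain ⟨π, g, b, h⟩ := hM.exists_optimal_penalize y
  obtain ⟨π', g', b', h'⟩ := hM.exists_optimal_penalize x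
  rw [(hM.penalize y).optAdvantage_eq h, (hM.penalize x).optAdvantage_eq h', Real.dist_eq,
    Real.dist_eq]
  refine (hM.penalize x).adv_sub_le h h' (fun a s => ?_) s
  rw [qValue_penalize, qValue_penalize]
  split_ifs
  · rw [sub_sub_sub_cancel_left, abs_sub_comm]
  · simp

/-- For large penalties it is optimal to rest everywhere, so that the optimal bias does not depend
on the penalty. -/
lemma HitBounded.exists_rest_optimal {D : ℝ} (hM : M.HitBounded D) : ∃ g b, ∃ Λ : ℝ,
    ∀ x, Λ ≤ x → (M.penalize x).IsOptimalTriple 0 g b := by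
  obtain ⟨g, b, h⟩ := hM.exists_isGainBias 0
  obtain ⟨Λ, hΛ⟩ := (Set.finite_range (M.adv b)).bddAbove
  refine ⟨g, b, Λ, fun x hx => ?_⟩
  have hx' : (M.penalize x).IsGainBias 0 g b := fun s => by
    rw [qValue_penalize, h s]
    simp
  refine hx'.isOptimalTriple_iff.2 fun s => ⟨by simp, fun _ => ?_⟩
  rw [adv_penalize]
  linarith [hΛ ⟨s, rfl⟩]

/-- For very negative penalties it is optimal to activate everywhere, so that the optimal bias does
not depend on the penalty. -/
lemma HitBounded.exists_activate_optimal {D : ℝ} (hM : M.HitBounded D) : ∃ g b, ∃ Λ : ℝ,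
    ∀ x, x ≤ Λ → (M.penalize x).IsOptimalTriple 1 (g - x) b := by
  obtain ⟨g, b, h⟩ := hM.exists_isGainBias 1
  obtain ⟨Λ, hΛ⟩ := (Set.finite_range (M.adv b)).bddBelow
  refine ⟨g, b, Λ, fun x hx => ?_⟩
  have hx' : (M.penalize x).IsGainBias 1 (g - x) b := fun s => by
    rw [qValue_penalize, Pi.one_apply, if_pos rfl]
    have := h s
    rw [Pi.one_apply] at this
    linarith
  refine hx'.isOptimalTriple_iff.2 fun s => ⟨fun _ => ?_, by simp⟩
  rw [adv_penalize]
  linarith [hΛ ⟨s, rfl⟩]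

lemma HitBounded.optAdvantage_right {D : ℝ} (hM : M.HitBounded D) (s : S) :
    ∃ k Λ : ℝ, ∀ x, Λ ≤ x → (M.penalize x).optAdvantage s = k - x := by
  obtain ⟨g, b, Λ, h⟩ := hM.exists_rest_optimal
  exact ⟨M.adv b s, Λ, fun x hx => by
    rw [(hM.penalize x).optAdvantage_eq (h x hx), adv_penalize]⟩

lemma HitBounded.optAdvantage_left {D : ℝ} (hM : M.HitBounded D) (s : S) :
    ∃ k Λ : ℝ, ∀ x, x ≤ Λ → (M.penalize x).optAdvantage s = k - x := by
  obtain ⟨g, b, Λ, h⟩ := hM.exists_activate_optimal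
  exact ⟨M.adv b s, Λ, fun x hx => by
    rw [(hM.penalize x).optAdvantage_eq (h x hx), adv_penalize]⟩

lemma HitBounded.exists_optAdvantage_eq_zero {D : ℝ} (hM : M.HitBounded D) (s : S) :
    ∃ x, (M.penalize x).optAdvantage s = 0 := by
  obtain ⟨k, Λ, h⟩ := hM.optAdvantage_right s
  obtain ⟨k', Λ', h'⟩ := hM.optAdvantage_left s
  have h1 := h (max Λ k) (le_max_left _ _)
  have h2 := h' (min Λ' k') (min_le_left _ _)
  exact mem_range_of_exists_le_of_exists_ge (hM.continuous_optAdvantage s)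
    ⟨max Λ k, by linarith [le_max_right Λ k]⟩ ⟨min Λ' k', by linarith [min_le_right Λ' k']⟩

/-- The gain and the bias of a fixed policy are affine in the penalty. -/
lemma HitBounded.exists_affine_isGainBias {D : ℝ} (hM : M.HitBounded D) (π : S → Fin 2) :
    ∃ (g g' : ℝ) (b b' : S → ℝ), ∀ x,
      (M.penalize x).IsGainBias π (g - x * g') fun s => b s - x * b' s := by
  obtain ⟨t, ht, -⟩ := hM π π
  obtain ⟨g, b, h⟩ := ht.exists_poisson (M.isStochastic π) fun s => M.r (π s) s
  obtain ⟨g', b', h'⟩ := ht.exists_poisson (M.isStochastic π) fun s => if π s = 1 then 1 else 0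
  refine ⟨g, g', b, b', fun x s => ?_⟩
  have e := h s
  have e' := congrArg (x * ·) (h' s)
  simp only [policyKernel] at e e'
  rw [qValue_penalize, qValue]
  simp only [mul_sub, Finset.sum_sub_distrib, mul_left_comm _ x, ← Finset.mul_sum]
  split_ifs at e' ⊢ <;> linarith

/-- The optimal biases of all the processes `M(x)` admit a common bound: on a compact set of
penalties this holds because there are finitely many policies, each with an affine bias, and
outside of it the optimal bias does not depend on the penalty. -/
lemma HitBounded.exists_bias_bound {D : ℝ} (hM : M.HitBounded D) : ∃ B : ℝ, ∀ x,
    ∃ π g b, (M.penalize x).IsOptimalTriple π g b ∧ ∀ s, |b s| ≤ B := by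
  obtain ⟨g₀, b₀, Λ₀, h₀⟩ := hM.exists_rest_optimal
  obtain ⟨g₁, b₁, Λ₁, h₁⟩ := hM.exists_activate_optimal
  choose g g' b b' h using hM.exists_affine_isGainBias
  obtain ⟨B₀, hB₀⟩ := (Set.finite_range fun s => |b₀ s|).bddAbove
  obtain ⟨B₁, hB₁⟩ := (Set.finite_range fun s => |b₁ s|).bddAbove
  obtain ⟨B₂, hB₂⟩ := (Set.finite_range fun p : (S → Fin 2) × S =>
    |b p.1 p.2| + max |Λ₀| |Λ₁| * |b' p.1 p.2|).bddAbove
  refine ⟨max B₀ (max B₁ B₂), fun x => ?_⟩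
  rcases le_total Λ₀ x with hx₀ | hx₀
  · exact ⟨_, _, _, h₀ x hx₀, fun s => (hB₀ ⟨s, rfl⟩).trans (le_max_left _ _)⟩
  rcases le_total x Λ₁ with hx₁ | hx₁
  · exact ⟨_, _, _, h₁ x hx₁, fun s =>
      (hB₁ ⟨s, rfl⟩).trans ((le_max_left _ _).trans (le_max_right _ _))⟩
  obtain ⟨π, γ, c, hπ⟩ := hM.exists_optimal_penalize x
  obtain ⟨hγ, k, hk⟩ := (hM.penalize x).isGainBias_unique hπ.1 (h π x)
  have hopt : (M.penalize x).IsOptimalTriple π (g π - x * g' π) fun s => b π s - x * b' π s := by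
    refine ⟨h π x, fun s a => ?_⟩
    rw [qValue_add_const hk, hγ]
    linarith [hπ.2 s a, hk s]
  refine ⟨_, _, _, hopt, fun s => ?_⟩
  have hx : |x| ≤ max |Λ₀| |Λ₁| := by
    refine abs_le.2 ⟨?_, ?_⟩
    · linarith [neg_abs_le Λ₁, le_max_right |Λ₀| |Λ₁|]
    · linarith [le_abs_self Λ₀, le_max_left |Λ₀| |Λ₁|]
  calc |b π s - x * b' π s| ≤ |b π s| + |x * b' π s| := abs_sub _ _
    _ ≤ |b π s| + max |Λ₀| |Λ₁| * |b' π s| := by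
        rw [abs_mul]
        gcongr
    _ ≤ _ := (hB₂ ⟨(π, s), rfl⟩).trans ((le_max_right _ _).trans (le_max_right _ _))

/-- The optimal advantages of `M(x)` and `N(x)` differ by at most a multiple of the distance of
the transition matrices, uniformly in the penalty `x`. -/
lemma HitBounded.exists_optAdvantage_sub_le {D : ℝ} (hM : M.HitBounded D) : ∃ C : ℝ, 0 ≤ C ∧
    ∀ N : TwoActionMDP S, N.HitBounded D → N.r = M.r → ∀ x s,
      |(M.penalize x).optAdvantage s - (N.penalize x).optAdvantage s| ≤ C * M.distInf N := by
  obtain ⟨B, hB⟩ := hM.exists_bias_bound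
  have hD : 0 ≤ D := by
    obtain ⟨t, ht, -⟩ := hM 0 0
    exact ht.nonneg
  have hB0 : 0 ≤ B := by
    obtain ⟨π, g, b, -, hb⟩ := hB 0
    exact (abs_nonneg _).trans (hb (Classical.arbitrary S))
  refine ⟨(2 + 4 * D) * B, by positivity, fun N hN hr x s => ?_⟩
  obtain ⟨π, g, b, h, hb⟩ := hB x
  obtain ⟨π', g', b', h'⟩ := hN.exists_optimal_penalize x
  rw [(hM.penalize x).optAdvantage_eq h, (hN.penalize x).optAdvantage_eq h', abs_sub_comm,
    mul_assoc]
  refine (hN.penalize x).adv_sub_le h h' (fun a s => ?_) s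
  rw [qValue_penalize, qValue_penalize, sub_sub_sub_cancel_right, qValue, qValue, hr,
    add_sub_add_left_eq_sub, ← Finset.sum_sub_distrib]
  calc |∑ t, (N.P a s t * b t - M.P a s t * b t)| ≤ ∑ t, |N.P a s t * b t - M.P a s t * b t| :=
        Finset.abs_sum_le_sum_abs _ _
    _ ≤ ∑ t, B * |M.P a s t - N.P a s t| := by
        refine Finset.sum_le_sum fun t _ => ?_
        rw [← sub_mul, abs_mul, abs_sub_comm, mul_comm]
        gcongr
        exact hb t
    _ ≤ B * M.distInf N := by
        rw [← Finset.mul_sum]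
        exact mul_le_mul_of_nonneg_left (M.sum_abs_sub_le_distInf N a s) hB0

/-! ### Whittle indices of indexable processes -/

lemma HitBounded.exists_isWhittleIndex {D : ℝ} (hM : M.HitBounded D) (hidx : M.Indexable)
    (s : S) : ∃ l, M.IsWhittleIndex s l := by
  let A : Set ℝ := {x | ∃ π, (M.penalize x).IsBellmanOptimal π ∧ π s = 1}
  have hne : A.Nonempty := by
    obtain ⟨g, b, Λ, h⟩ := hM.exists_activate_optimal
    exact ⟨Λ, 1, isBellmanOptimal_iff.2 ⟨_, _, h Λ le_rfl⟩, rfl⟩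
  have hbdd : BddAbove A := by
    obtain ⟨k, Λ, h⟩ := hM.optAdvantage_right s
    refine ⟨max Λ k, fun x hx => ?_⟩
    obtain ⟨π, hπ, hs⟩ := hx
    by_contra! hlt
    have h1 := (((hM.penalize x).isBellmanOptimal_iff_sign.1 hπ) s).1 hs
    rw [h x ((le_max_left _ _).trans hlt.le)] at h1
    linarith [le_max_right Λ k]
  refine ⟨sSup A, fun x hx π hπ => ?_, fun x hx π hπ => ?_⟩
  · obtain ⟨y, ⟨π', hπ', hs⟩, hxy⟩ := exists_lt_of_lt_csSup hne hx
    exact hidx x y hxy π π' hπ hπ' s hs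
  · by_contra h
    have : π s = 1 := by omega
    exact hx.not_ge (le_csSup hbdd ⟨π, hπ, this⟩)

/-- If the optimal advantage of `s` vanished, there would be optimal policies of both kinds. -/
lemma HitBounded.optAdvantage_ne_zero {D : ℝ} (hM : M.HitBounded D) {s : S} {l x : ℝ}
    (hl : M.IsWhittleIndex s l) (hx : x ≠ l) : (M.penalize x).optAdvantage s ≠ 0 := by
  classical
  intro h0
  obtain ⟨π, hπ⟩ : ∃ π, (M.penalize x).IsBellmanOptimal π := by
    obtain ⟨π, h⟩ := hM.exists_optimal_penalize x
    exact ⟨π, isBellmanOptimal_iff.2 h⟩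
  have key : ∀ a, (M.penalize x).IsBellmanOptimal (Function.update π s a) := fun a => by
    rw [(hM.penalize x).isBellmanOptimal_iff_sign] at hπ ⊢
    intro u
    by_cases hu : u = s
    · subst hu
      simp [h0]
    · simpa [Function.update_of_ne hu] using hπ u
  rcases hx.lt_or_gt with h | h
  · simpa using hl.1 x h _ (key 0)
  · simpa using hl.2 x h _ (key 1)

/-- On a closed set on which it vanishes at most at `z`, an affine function is bounded below by a
multiple of the distance to `z`, provided that the set is bounded or the function is not
constant. -/
lemma exists_mul_abs_sub_le_of_affine {F : Set ℝ} (hF : IsClosed F) {m k z : ℝ}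
    (hm : m = 0 → ∃ R, ∀ x ∈ F, |x| ≤ R) (h0 : ∀ x ∈ F, x ≠ z → m * x + k ≠ 0) :
    ∃ κ > 0, ∀ x ∈ F, κ * |x - z| ≤ |m * x + k| := by
  by_cases hm0 : m = 0
  · obtain ⟨R, hR⟩ := hm hm0
    subst hm0
    simp only [zero_mul, zero_add] at h0 ⊢
    by_cases hk : k = 0
    · refine ⟨1, one_pos, fun x hx => ?_⟩
      have : x = z := by
        by_contra h
        exact h0 x hx h hk
      simp [this]
    · have hpos : 0 < |R| + |z| + 1 := by positivity
      refine ⟨|k| / (|R| + |z| + 1), div_pos (abs_pos.2 hk) hpos, fun x hx => ?_⟩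
      rw [div_mul_eq_mul_div, div_le_iff₀ hpos]
      refine mul_le_mul_of_nonneg_left ?_ (abs_nonneg k)
      linarith [abs_sub x z, hR x hx, le_abs_self R]
  · -- `y` is the zero of the affine function.
    obtain ⟨y, rfl⟩ : ∃ y, k = -(m * y) := ⟨-k / m, by field_simp⟩
    have e : ∀ x, |m * x + -(m * y)| = |m| * |x - y| := fun x => by
      rw [← abs_mul]; congr 1; ring
    simp only [e]
    by_cases hyz : y = z
    · exact ⟨|m|, abs_pos.2 hm0, fun x _ => by rw [hyz]⟩
    · have hyF : y ∈ Fᶜ := fun hy => h0 y hy hyz (by ring)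
      obtain ⟨ε, hε, hball⟩ := Metric.isOpen_iff.1 hF.isOpen_compl y hyF
      have hpos : 0 < 1 + |y - z| / ε := by positivity
      refine ⟨|m| / (1 + |y - z| / ε), div_pos (abs_pos.2 hm0) hpos, fun x hx => ?_⟩
      have hdist : ε ≤ |x - y| := by
        by_contra! h
        exact hball (by rwa [Metric.mem_ball, Real.dist_eq]) hx
      rw [div_mul_eq_mul_div, div_le_iff₀ hpos, mul_assoc]
      refine mul_le_mul_of_nonneg_left ?_ (abs_nonneg m)
      have h1 : |y - z| ≤ |x - y| * (|y - z| / ε) := by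
        rw [← mul_div_assoc, le_div_iff₀ hε, mul_comm]
        exact mul_le_mul_of_nonneg_right hdist (abs_nonneg _)
      linarith [abs_sub_le x y z]

/-- The optimal advantage of an indexable process grows at least linearly away from the Whittle
index. On the closed set of penalties for which a given policy is optimal it is affine, and there
are finitely many policies. -/
lemma HitBounded.exists_mul_abs_sub_le {D : ℝ} (hM : M.HitBounded D) {s : S} {l : ℝ}
    (hl : M.IsWhittleIndex s l) :
    ∃ κ > 0, ∀ x, κ * |x - l| ≤ |(M.penalize x).optAdvantage s| := by
  have key : ∀ π : S → Fin 2, ∃ κ > 0, ∀ x, (M.penalize x).IsBellmanOptimal π →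
      κ * |x - l| ≤ |(M.penalize x).optAdvantage s| := by
    intro π
    let F : Set ℝ := {x | (M.penalize x).IsBellmanOptimal π}
    have hF : IsClosed F := by
      have : F = ⋂ u, {x | (π u = 1 → 0 ≤ (M.penalize x).optAdvantage u) ∧
          (π u = 0 → (M.penalize x).optAdvantage u ≤ 0)} := by
        ext x
        simp only [Set.mem_iInter]
        exact (hM.penalize x).isBellmanOptimal_iff_sign
      rw [this]
      refine isClosed_iInter fun u => ?_
      have hc := hM.continuous_optAdvantage u
      have : π u = 0 ∨ π u = 1 := by omega
      rcases this with h | h <;> simp only [h]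
      · simpa using isClosed_le hc continuous_const
      · simpa using isClosed_le continuous_const hc
    obtain ⟨m, k, hmk⟩ : ∃ m k : ℝ, ∀ x ∈ F, (M.penalize x).optAdvantage s = m * x + k := by
      obtain ⟨g, g', b, b', h⟩ := hM.exists_affine_isGainBias π
      refine ⟨-1 - ∑ t, (M.P 1 s t - M.P 0 s t) * b' t, M.adv b s, fun x hx => ?_⟩
      obtain ⟨γ, c, hc⟩ := isBellmanOptimal_iff.1 hx
      obtain ⟨-, j, hj⟩ := (hM.penalize x).isGainBias_unique hc.1 (h x)
      have e : (M.penalize x).adv (fun s => b s - x * b' s) s = (M.penalize x).adv c s := by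
        simp only [adv, qValue_add_const hj]
        ring
      rw [(hM.penalize x).optAdvantage_eq hc, ← e, adv_penalize, adv_eq, adv_eq]
      simp only [mul_sub _ _ (x * _), Finset.sum_sub_distrib, mul_left_comm _ x, ← Finset.mul_sum]
      ring
    obtain ⟨κ, hκ, h⟩ := exists_mul_abs_sub_le_of_affine hF (m := m) (k := k) (z := l)
      (fun hm => by
        -- The advantage has slope `-1` near both infinities, hence it is not constant there.
        obtain ⟨p, Λ, hr⟩ := hM.optAdvantage_right s
        obtain ⟨q, Λ', hl'⟩ := hM.optAdvantage_left s
        refine ⟨max (|Λ| + |p - k|) (|Λ'| + |q - k|), fun x hx => ?_⟩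
        have hxk := hmk x hx
        rw [hm, zero_mul, zero_add] at hxk
        refine abs_le.2 ⟨?_, ?_⟩
        · refine neg_le.1 (le_trans ?_ (le_max_right _ _))
          rcases le_total x Λ' with h | h
          · have := hl' x h
            linarith [neg_abs_le (q - k), abs_nonneg Λ']
          · linarith [neg_abs_le Λ', abs_nonneg (q - k)]
        · refine le_trans ?_ (le_max_left _ _)
          rcases le_total Λ x with h | h
          · have := hr x h
            linarith [le_abs_self (p - k), abs_nonneg Λ]
          · linarith [le_abs_self Λ, abs_nonneg (p - k)])
      (fun x hx hxl => hmk x hx ▸ hM.optAdvantage_ne_zero hl hxl)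
    exact ⟨κ, hκ, fun x hx => (h x hx).trans_eq (by rw [hmk x hx])⟩
  choose κ hκ h using key
  obtain ⟨π₀, hπ₀⟩ := Finite.exists_min κ
  refine ⟨κ π₀, hκ π₀, fun x => ?_⟩
  obtain ⟨π, hπ⟩ := hM.exists_optimal_penalize x
  exact (mul_le_mul_of_nonneg_right (hπ₀ π) (abs_nonneg _)).trans
    (h π x (isBellmanOptimal_iff.2 hπ))

end TwoActionMDP

/-! ### Whittle indices of an estimate -/

theorem mainTheorem1 {S : Type*} [Fintype S] [Nonempty S] (M : TwoActionMDP S)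
    (hM : M.Unichain) (hidx : M.Indexable) :
    ∃ lam : S → ℝ, (∀ s, M.IsWhittleIndex s (lam s)) ∧
      ∃ δ c : ℝ, 0 < δ ∧ 0 < c ∧
        ∀ N : TwoActionMDP S, M.SameSupport N → N.r = M.r → M.CloseEstimate N lam →
          (M.distInf N ≤ δ → ∀ x : ℝ, (∀ s, x ≤ lam s - δ ∨ lam s + δ ≤ x) →
            (M.penalize x).SameUniqueOptimal (N.penalize x)) ∧
          (∀ x : ℝ, (∀ s, c * M.distInf N < |x - lam s|) →
            (M.penalize x).SameUniqueOptimal (N.penalize x)) ∧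
          (∀ s, (∃ x : ℝ, (N.penalize x).optAdvantage s = 0) ∧
            ∀ x : ℝ, (N.penalize x).optAdvantage s = 0 → |lam s - x| ≤ c * M.distInf N) := by
  obtain ⟨D, hD⟩ := hM.exists_hitBounded
  have hMD : M.HitBounded D := hD M fun π => by simp [M.distInf_self]
  choose lam hlam using hMD.exists_isWhittleIndex hidx
  choose κ hκ hκ' using fun s => hMD.exists_mul_abs_sub_le (hlam s)
  obtain ⟨s₀, hs₀⟩ := Finite.exists_min κ
  have hgrow : ∀ s x, κ s₀ * |x - lam s| ≤ |(M.penalize x).optAdvantage s| := fun s x =>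
    (mul_le_mul_of_nonneg_right (hs₀ s) (abs_nonneg _)).trans (hκ' s x)
  obtain ⟨C, hC, hpert⟩ := hMD.exists_optAdvantage_sub_le
  have hκ₀ := hκ s₀
  let c := (C + 1) / κ s₀
  have hc : 0 < c := by positivity
  have hcκ : κ s₀ * c = C + 1 := by
    simp only [c]
    field_simp
  -- Since `distInf` never exceeds `2`, the choice `δ > 2 * c` makes the statement about `δ` a case
  -- of the one about `c`.
  refine ⟨lam, hlam, 2 * c + 1, c, by positivity, hc, fun N _ hr hclose => ?_⟩
  have hND := hD N hclose.1
  have hdist := M.distInf_nonneg N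
  have unique : ∀ x : ℝ, (∀ s, c * M.distInf N < |x - lam s|) →
      (M.penalize x).SameUniqueOptimal (N.penalize x) := fun x hx => by
    refine (hMD.penalize x).sameUniqueOptimal (hND.penalize x) fun s => ?_
    have h1 := mul_lt_mul_of_pos_left (hx s) hκ₀
    rw [← mul_assoc, hcκ] at h1
    linarith [hgrow s x, hpert N hND hr x s]
  refine ⟨fun _ x hx => unique x fun s => ?_, unique, fun s =>
    ⟨hND.exists_optAdvantage_eq_zero s, fun x hx => ?_⟩⟩
  · have h1 : c * M.distInf N ≤ c * 2 := mul_le_mul_of_nonneg_left (M.distInf_le_two N) hc.le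
    rcases hx s with h | h
    · linarith [neg_abs_le (x - lam s)]
    · linarith [le_abs_self (x - lam s)]
  · have h1 := hpert N hND hr x s
    rw [hx, sub_zero] at h1
    have h2 := hgrow s x
    rw [abs_sub_comm]
    refine le_of_mul_le_mul_left ?_ hκ₀
    rw [← mul_assoc, hcκ]
    linarith
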